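/- Let $(\mathcal X,d)$ be a complete separable metric space, let $\lambda>0$, put $c_\lambda(x,y)=\min\{d(x,y),2\lambda\}$, and let $\mu,\nu$ be Borel probability measures on $\mathcal X$. A function $\psi:\mathcal X\to\mathbb R\cup\{+\infty\}$ is called $c_\lambda$-convex if it is not identically $+\infty$ and there is $\zeta:\mathcal X\to\mathbb R\cup\{\pm\infty\}$ with $\psi(x)=\sup_{y}[\zeta(y)-c_\lambda(x,y)]$ for all $x$; its $c_\lambda$-transform is $\psi^{c}(y)=\inf_{x}[\psi(x)+c_\lambda(x,y)]$. 1. Every $c_\lambda$-convex function $\psi$ satisfies $\psi^{c}=\psi$. 2. With $\Pi(\mu,\nu)$ the set of couplings of $\mu$ and $\nu$, $$\inf_{\pi\in\Pi(\mu,\nu)}\int_{\mathcal X\times\mathcal X}c_\lambda\,d\pi=\sup\Big\{\int_{\mathcal X}\psi\,d\mu-\int_{\mathcal X}\psi\,d\nu:\ \psi\in C_b(\mathcal X),\ |\psi(x)-\psi(y)|\le d(x,y)\ \text{for all } x,y,\ \sup\psi-\inf\psi\le 2\lambda\Big\},$$ and the supremum is attained. 3. Call $\psi\in C_b(\mathcal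 X)$ a Kantorovich potential if $\psi$ is $c_\lambda$-convex, $\psi^{c}\in C_b(\mathcal X)$, and the pair $(\phi,\psi)$ with $\phi=\psi^{c}$ maximizes $\int\phi\,d\mu-\int\psi\,d\nu$ among all $\phi,\psi\in C_b(\mathcal X)$ with $\phi(y)-\psi(x)\le c_\lambda(x,y)$ for all $x,y$. A Kantorovich potential exists, and every Kantorovich potential satisfies the constraints in the supremum in 2 and attains that supremum. -/

import Mathlib

open MeasureTheory
open scoped BoundedContinuousFunction

noncomputable section

namespace RobustOT

/-- The set `Π(μ, ν)` of couplings: joint measures with first marginal `μ` and second marginal `ν`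
(automatically probability measures when `μ` is one). -/
def couplings {X Y : Type*} [MeasurableSpace X] [MeasurableSpace Y]
    (μ : Measure X) (ν : Measure Y) : Set (Measure (X × Y)) :=
  {π | π.map Prod.fst = μ ∧ π.map Prod.snd = ν}

/-- The truncated cost `c_λ(x, y) = min {d(x, y), 2 λ}`. -/
def truncCost {X : Type*} [MetricSpace X] (lam : ℝ) (x y : X) : ℝ :=
  min (dist x y) (2 * lam)

/-- The (primal) value of the robust optimal transport problem,
`inf { ∫ c_λ dπ : π ∈ Π(μ, ν) }`. For probability measures the set is non-empty (it contains the
product coupling) and, for `λ > 0`, bounded below by `0`, and every integrand is integrable. -/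
def robustValue {X : Type*} [MetricSpace X] [MeasurableSpace X]
    (lam : ℝ) (μ ν : Measure X) : ℝ :=
  sInf {r | ∃ π ∈ couplings μ ν, r = ∫ p, truncCost lam p.1 p.2 ∂π}

/-- `ψ : X → ℝ ∪ {+∞}` is `c`-convex: it is not identically `+∞` and there is
`ζ : Y → ℝ ∪ {±∞}` with `ψ(x) = sup_y [ζ(y) - c(x, y)]` for all `x`. -/
def IsCConvex {X Y : Type*} (c : X → Y → ℝ) (ψ : X → EReal) : Prop :=
  (∀ x, ψ x ≠ ⊥) ∧ (∃ x, ψ x ≠ ⊤) ∧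
    ∃ ζ : Y → EReal, ∀ x, ψ x = ⨆ y, (ζ y - ((c x y : ℝ) : EReal))

/-- The `c`-transform `ψ^c(y) = inf_x [ψ(x) + c(x, y)]`. -/
def cTransform {X Y : Type*} (c : X → Y → ℝ) (ψ : X → EReal) (y : Y) : EReal :=
  ⨅ x, (ψ x + ((c x y : ℝ) : EReal))

/-- The values of the Kantorovich dual problem for the cost `c`: the numbers `∫ φ dν - ∫ ψ dμ`
with `φ ∈ C_b(Y)`, `ψ ∈ C_b(X)` and `φ(y) - ψ(x) ≤ c(x, y)` for all `(x, y)`. -/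
def kantorovichDualValues {X Y : Type*} [TopologicalSpace X] [TopologicalSpace Y]
    [MeasurableSpace X] [MeasurableSpace Y]
    (c : X → Y → ℝ) (μ : Measure X) (ν : Measure Y) : Set ℝ :=
  {r | ∃ (φ : Y →ᵇ ℝ) (ψ : X →ᵇ ℝ), (∀ x y, φ y - ψ x ≤ c x y) ∧
    r = ∫ y, φ y ∂ν - ∫ x, ψ x ∂μ}

/-- `ψ ∈ C_b(X)` is a Kantorovich potential for the transport of `μ` to `ν` with cost `c`:
it is `c`-convex, its `c`-transform `φ` is in `C_b(Y)`, and the pair `(φ, ψ)` solves the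
Kantorovich dual problem. -/
def IsKantorovichPotential {X Y : Type*} [TopologicalSpace X] [TopologicalSpace Y]
    [MeasurableSpace X] [MeasurableSpace Y]
    (c : X → Y → ℝ) (μ : Measure X) (ν : Measure Y) (ψ : X →ᵇ ℝ) : Prop :=
  IsCConvex c (fun x => ((ψ x : ℝ) : EReal)) ∧
    ∃ φ : Y →ᵇ ℝ, (∀ y, ((φ y : ℝ) : EReal) = cTransform c (fun x => ((ψ x : ℝ) : EReal)) y) ∧
      IsGreatest (kantorovichDualValues c μ ν) (∫ y, φ y ∂ν - ∫ x, ψ x ∂μ)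

/-- The constraints of the robust dual problem: `ψ` is `1`-Lipschitz for `d`, and its range (its
oscillation `sup ψ - inf ψ`) is at most `2 λ`. -/
def RobustFeasible {X : Type*} [MetricSpace X] (lam : ℝ) (ψ : X →ᵇ ℝ) : Prop :=
  (∀ x y, |ψ x - ψ y| ≤ dist x y) ∧ ∀ x y, ψ x - ψ y ≤ 2 * lam

/-- The values `∫ ψ dμ - ∫ ψ dν` of the robust dual problem. -/
def robustDualValues {X : Type*} [MetricSpace X] [MeasurableSpace X]
    (lam : ℝ) (μ ν : Measure X) : Set ℝ :=
  {r | ∃ ψ : X →ᵇ ℝ, RobustFeasible lam ψ ∧ r = ∫ x, ψ x ∂μ - ∫ x, ψ x ∂ν}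

end RobustOT

end

/-! Truncating a metric gives a metric, so `truncCost` satisfies the triangle inequality. Hence
`c_λ`-convex functions are real-valued and 1-Lipschitz for `c_λ` (`IsCConvex.exists_real`), such
functions equal their own transform (`cTransform_coe_eq_self`), and this Lipschitz condition is
exactly the robust constraint (`robustFeasible_iff`). Dual pairs thus collapse to a single function.

Weak duality is integration of the constraint. For the converse, a finitely valued map nearly
preserving points reduces the problem to a matrix problem, solved by Hahn–Banach
(`exists_dual_of_lt_cost`). Matrices lift to couplings (`exists_coupling_of_matrix`), and finite
dual variables extend to `X` by inf-convolution (`exists_robustFeasible_between`). A compactness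
argument turns near-optimal functions into an optimal one. -/

namespace RobustOT

/-! ### Finite linear programming duality -/

/-- Finite Kantorovich duality: if every coupling of two finite probability vectors costs more than
`v`, then some feasible pair of dual variables has value more than `v`. -/
theorem exists_dual_of_lt_cost {ι κ : Type*} [Fintype ι] [Fintype κ]
    (c : ι → κ → ℝ) (a : ι → ℝ) (b : κ → ℝ) (ha : ∀ i, 0 ≤ a i) (hb : ∀ j, 0 ≤ b j)
    (ha1 : ∑ i, a i = 1) (hb1 : ∑ j, b j = 1) (v : ℝ)
    (hv : ∀ p : ι → κ → ℝ, (∀ i j, 0 ≤ p i j) → (∀ i, ∑ j, p i j = a i) →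
      (∀ j, ∑ i, p i j = b j) → v < ∑ i, ∑ j, p i j * c i j) :
    ∃ (φ : ι → ℝ) (ψ : κ → ℝ), (∀ i j, φ i - ψ j ≤ c i j) ∧
      v < ∑ i, φ i * a i - ∑ j, ψ j * b j := by
  classical
  -- `L` records both marginals and the cost; the point `(a, b, v)` misses the compact convex image
  -- of the simplex, so it can be strictly separated.
  let L : (ι × κ → ℝ) →ₗ[ℝ] (ι → ℝ) × (κ → ℝ) × ℝ :=
    { toFun := fun p => (fun i => ∑ j, p (i, j), fun j => ∑ i, p (i, j),
        ∑ i, ∑ j, p (i, j) * c i j)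
      map_add' := fun p q => by
        ext <;> simp [Finset.sum_add_distrib, add_mul]
      map_smul' := fun r p => by
        ext <;> simp [Finset.mul_sum, mul_assoc] }
  have hLc : Continuous L := L.continuous_of_finiteDimensional
  have hK : IsClosed (L '' stdSimplex ℝ (ι × κ)) :=
    ((isCompact_stdSimplex ℝ (ι × κ)).image hLc).isClosed
  have hKc : Convex ℝ (L '' stdSimplex ℝ (ι × κ)) :=
    (convex_stdSimplex ℝ (ι × κ)).linear_image L
  have hnot : (a, b, v) ∉ L '' stdSimplex ℝ (ι × κ) := by
    rintro ⟨p, hp, hpe⟩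
    simp only [L, LinearMap.coe_mk, AddHom.coe_mk, Prod.mk.injEq] at hpe
    obtain ⟨h1, h2, h3⟩ := hpe
    have := hv (fun i j => p (i, j)) (fun i j => hp.1 _) (fun i => congrFun h1 i)
      (fun j => congrFun h2 j)
    exact absurd h3 this.ne'
  obtain ⟨f, u, hf1, hf2⟩ := geometric_hahn_banach_closed_point hKc hK hnot
  set A : ι → ℝ := fun i => f (Pi.single i 1, 0, 0)
  set B : κ → ℝ := fun j => f (0, Pi.single j 1, 0)
  set s : ℝ := f (0, 0, 1)
  have hfeq : ∀ (x : ι → ℝ) (y : κ → ℝ) (t : ℝ),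
      f (x, y, t) = ∑ i, A i * x i + ∑ j, B j * y j + s * t := by
    intro x y t
    have hx : f (x, 0, 0) = ∑ i, A i * x i := by
      have := LinearMap.pi_apply_eq_sum_univ
        (f.toLinearMap ∘ₗ LinearMap.inl ℝ (ι → ℝ) ((κ → ℝ) × ℝ)) x
      simp only [LinearMap.comp_apply, LinearMap.inl_apply, smul_eq_mul] at this
      refine this.trans (Finset.sum_congr rfl fun i _ => ?_)
      rw [mul_comm]
      congr 1
      refine congrArg f (Prod.ext ?_ rfl)
      ext j
      simp [Pi.single_apply, eq_comm]
    have hy : f (0, y, 0) = ∑ j, B j * y j := by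
      have := LinearMap.pi_apply_eq_sum_univ
        (f.toLinearMap ∘ₗ LinearMap.inr ℝ (ι → ℝ) ((κ → ℝ) × ℝ) ∘ₗ LinearMap.inl ℝ (κ → ℝ) ℝ) y
      simp only [LinearMap.comp_apply, LinearMap.inl_apply, LinearMap.inr_apply,
        smul_eq_mul] at this
      refine this.trans (Finset.sum_congr rfl fun i _ => ?_)
      rw [mul_comm]
      congr 1
      refine congrArg f (Prod.ext rfl (Prod.ext ?_ rfl))
      ext j
      simp [Pi.single_apply, eq_comm]
    have ht : f (0, 0, t) = s * t := by
      have : ((0, 0, t) : (ι → ℝ) × (κ → ℝ) × ℝ) = t • (0, 0, 1) := by simp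
      rw [this, map_smul, smul_eq_mul, mul_comm]
    have : ((x, y, t) : (ι → ℝ) × (κ → ℝ) × ℝ) = (x, 0, 0) + (0, y, 0) + (0, 0, t) := by simp
    rw [this, map_add, map_add, hx, hy, ht]
  have hprod : v < ∑ i, ∑ j, a i * b j * c i j :=
    hv (fun i j => a i * b j) (fun i j => mul_nonneg (ha i) (hb j))
      (fun i => by rw [← Finset.mul_sum, hb1, mul_one])
      (fun j => by rw [← Finset.sum_mul, ha1, one_mul])
  -- The product coupling has marginals `a`, `b` and cost above `v`, so separation forces a negative
  -- cost coefficient.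
  have hs0 : s < 0 := by
    have h := hf1 (L fun q => a q.1 * b q.2) ⟨_, ⟨fun q => mul_nonneg (ha _) (hb _), by
      rw [Fintype.sum_prod_type]; simp [← Finset.mul_sum, hb1, ha1]⟩, rfl⟩
    have hL : L (fun q => a q.1 * b q.2) = (a, b, ∑ i, ∑ j, a i * b j * c i j) := by
      ext <;> simp [L, ← Finset.mul_sum, ← Finset.sum_mul, hb1, ha1]
    rw [hL, hfeq] at h
    rw [hfeq] at hf2
    nlinarith
  -- Testing at the vertices of the simplex gives the dual constraint entry by entry.
  have hδ : ∀ i j, A i + B j + s * c i j < u := by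
    intro i j
    have h := hf1 (L (Pi.single (i, j) 1)) ⟨_, single_mem_stdSimplex ℝ _, rfl⟩
    have hL : L (Pi.single (i, j) 1) = (Pi.single i 1, Pi.single j 1, c i j) := by
      ext k
      · simp [L, Pi.single_apply, Prod.ext_iff, ite_and, Finset.sum_ite_eq']
      · simp [L, Pi.single_apply, Prod.ext_iff, ite_and, Finset.sum_ite_eq']
      · simp [L, Pi.single_apply, Prod.ext_iff, ite_and, Finset.sum_ite_eq']
    rw [hL, hfeq] at h
    simpa [Pi.single_apply] using h
  rw [hfeq] at hf2
  -- Dividing by `-s` normalizes the cost coefficient; the threshold `u` is absorbed into the first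
  -- variable because `a` sums to 1.
  refine ⟨fun i => (A i - u) / (-s), fun j => B j / s, fun i j => ?_, ?_⟩
  · have : (A i - u) / (-s) - B j / s = (A i + B j - u) / (-s) := by
      field_simp [hs0.ne]; ring
    rw [this, div_le_iff₀ (by linarith)]
    nlinarith [hδ i j]
  · have h1 : ∑ i, (A i - u) / (-s) * a i = (∑ i, A i * a i - u) / (-s) := by
      have : ∑ i, (A i - u) * a i = ∑ i, A i * a i - u := by
        simp [sub_mul, Finset.sum_sub_distrib, ← Finset.mul_sum, ha1]
      rw [← this, Finset.sum_div]
      exact Finset.sum_congr rfl fun i _ => by ring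
    have h2 : ∑ j, B j / s * b j = (∑ j, B j * b j) / s := by
      rw [Finset.sum_div]
      exact Finset.sum_congr rfl fun i _ => by ring
    rw [h1, h2]
    have : (∑ i, A i * a i - u) / (-s) - (∑ j, B j * b j) / s
        = (∑ i, A i * a i + ∑ j, B j * b j - u) / (-s) := by
      field_simp [hs0.ne]; ring
    rw [this, lt_div_iff₀ (by linarith)]
    linarith

/-! ### Lifting matrices to couplings -/

open ProbabilityTheory in
/-- A matrix whose row and column sums are the laws of `s` and `t` lifts to a coupling of `μ` and
`ν` under which the joint law of `s` and `t` is that matrix. -/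
theorem exists_coupling_of_matrix {X Y ι κ : Type*} [MeasurableSpace X] [MeasurableSpace Y]
    [Fintype ι] [Fintype κ] [MeasurableSpace ι] [MeasurableSpace κ]
    [MeasurableSingletonClass ι] [MeasurableSingletonClass κ]
    (μ : Measure X) (ν : Measure Y) [IsFiniteMeasure μ] [IsFiniteMeasure ν]
    {s : X → ι} {t : Y → κ} (hs : Measurable s) (ht : Measurable t)
    (p : ι → κ → ℝ) (hp : ∀ i j, 0 ≤ p i j)
    (hrow : ∀ i, ∑ j, p i j = μ.real (s ⁻¹' {i}))
    (hcol : ∀ j, ∑ i, p i j = ν.real (t ⁻¹' {j})) :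
    ∃ π ∈ couplings μ ν, ∀ i j, π.real ((s ⁻¹' {i}) ×ˢ (t ⁻¹' {j})) = p i j := by
  classical
  have hms : ∀ i, MeasurableSet (s ⁻¹' {i}) := fun i => hs (measurableSet_singleton i)
  have hmt : ∀ j, MeasurableSet (t ⁻¹' {j}) := fun j => ht (measurableSet_singleton j)
  -- Conditioning on a null cell gives the zero measure, which is harmless because the matrix
  -- vanishes there.
  have hpμ : ∀ i j, μ (s ⁻¹' {i}) = 0 → p i j = 0 := by
    intro i j h
    have h0 : ∑ j, p i j = 0 := by rw [hrow, measureReal_def, h, ENNReal.toReal_zero]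
    exact (Finset.sum_eq_zero_iff_of_nonneg fun j _ => hp i j).1 h0 j (Finset.mem_univ j)
  have hpν : ∀ i j, ν (t ⁻¹' {j}) = 0 → p i j = 0 := by
    intro i j h
    have h0 : ∑ i, p i j = 0 := by rw [hcol, measureReal_def, h, ENNReal.toReal_zero]
    exact (Finset.sum_eq_zero_iff_of_nonneg fun i _ => hp i j).1 h0 i (Finset.mem_univ i)
  have hmμ : ∀ i j, ENNReal.ofReal (p i j) * (μ[|s ⁻¹' {i}]) Set.univ = ENNReal.ofReal (p i j) := by
    intro i j
    by_cases h : μ (s ⁻¹' {i}) = 0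
    · simp [hpμ i j h]
    · have := cond_isProbabilityMeasure (μ := μ) h
      simp
  have hmν : ∀ i j, ENNReal.ofReal (p i j) * (ν[|t ⁻¹' {j}]) Set.univ = ENNReal.ofReal (p i j) := by
    intro i j
    by_cases h : ν (t ⁻¹' {j}) = 0
    · simp [hpν i j h]
    · have := cond_isProbabilityMeasure (μ := ν) h
      simp
  -- Inside each cell the two conditional laws are coupled independently, with weight `p i j`.
  refine ⟨∑ i, ∑ j, ENNReal.ofReal (p i j) • (μ[|s ⁻¹' {i}]).prod (ν[|t ⁻¹' {j}]), ⟨?_, ?_⟩, ?_⟩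
  · rw [Measure.map_finset_sum measurable_fst.aemeasurable]
    conv_rhs => rw [← sum_meas_smul_cond_fiber hs μ]
    refine Finset.sum_congr rfl fun i _ => ?_
    rw [Measure.map_finset_sum measurable_fst.aemeasurable]
    have : ∀ j, (ENNReal.ofReal (p i j) • (μ[|s ⁻¹' {i}]).prod (ν[|t ⁻¹' {j}])).map Prod.fst
        = ENNReal.ofReal (p i j) • μ[|s ⁻¹' {i}] := fun j => by
      rw [Measure.map_smul, Measure.map_fst_prod, smul_smul, hmν]
    simp_rw [this]
    rw [← Finset.sum_smul, ← ENNReal.ofReal_sum_of_nonneg fun j _ => hp i j, hrow,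
      ofReal_measureReal]
  · rw [Finset.sum_comm, Measure.map_finset_sum measurable_snd.aemeasurable]
    conv_rhs => rw [← sum_meas_smul_cond_fiber ht ν]
    refine Finset.sum_congr rfl fun j _ => ?_
    rw [Measure.map_finset_sum measurable_snd.aemeasurable]
    have : ∀ i, (ENNReal.ofReal (p i j) • (μ[|s ⁻¹' {i}]).prod (ν[|t ⁻¹' {j}])).map Prod.snd
        = ENNReal.ofReal (p i j) • ν[|t ⁻¹' {j}] := fun i => by
      rw [Measure.map_smul, Measure.map_snd_prod, smul_smul, hmμ]
    simp_rw [this]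
    rw [← Finset.sum_smul, ← ENNReal.ofReal_sum_of_nonneg fun i _ => hp i j, hcol,
      ofReal_measureReal]
  · intro i j
    have hcell : ∀ i' j', (ENNReal.ofReal (p i' j') •
        (μ[|s ⁻¹' {i'}]).prod (ν[|t ⁻¹' {j'}])) ((s ⁻¹' {i}) ×ˢ (t ⁻¹' {j}))
        = if i' = i then (if j' = j then ENNReal.ofReal (p i j) else 0) else 0 := by
      intro i' j'
      rw [Measure.smul_apply, Measure.prod_prod, smul_eq_mul]
      split_ifs with h1 h2
      · subst h1 h2
        by_cases hμ : μ (s ⁻¹' {i'}) = 0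
        · simp [hpμ i' j' hμ]
        by_cases hν : ν (t ⁻¹' {j'}) = 0
        · simp [hpν i' j' hν]
        rw [cond_apply_self hμ (measure_ne_top _ _), cond_apply_self hν (measure_ne_top _ _)]
        simp
      · rw [cond_apply (hmt j'), ← Set.preimage_inter, Set.singleton_inter_eq_empty.2 (by simpa)]
        simp
      · rw [cond_apply (hms i'), ← Set.preimage_inter, Set.singleton_inter_eq_empty.2 (by simpa)]
        simp
    rw [measureReal_def, Measure.finsetSum_apply]
    simp only [Measure.finsetSum_apply, hcell]
    simp [hp i j]

theorem integral_eq_sum_of_joint_law {X Y ι κ : Type*} [MeasurableSpace X] [MeasurableSpace Y]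
    [Fintype ι] [Fintype κ] [MeasurableSpace ι] [MeasurableSpace κ]
    [MeasurableSingletonClass ι] [MeasurableSingletonClass κ]
    (π : Measure (X × Y)) [IsFiniteMeasure π]
    {s : X → ι} {t : Y → κ} (hs : Measurable s) (ht : Measurable t) (c : ι → κ → ℝ) :
    ∫ z, c (s z.1) (t z.2) ∂π
      = ∑ i, ∑ j, π.real ((s ⁻¹' {i}) ×ˢ (t ⁻¹' {j})) * c i j := by
  have hst : Measurable fun z : X × Y => (s z.1, t z.2) :=
    (hs.comp measurable_fst).prodMk (ht.comp measurable_snd)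
  have h := integral_map (μ := π) hst.aemeasurable (f := fun q : ι × κ => c q.1 q.2)
    (measurable_of_finite _).aestronglyMeasurable
  rw [← h, integral_fintype .of_finite, Fintype.sum_prod_type]
  refine Finset.sum_congr rfl fun i _ => Finset.sum_congr rfl fun j _ => ?_
  rw [map_measureReal_apply hst (measurableSet_singleton _), smul_eq_mul]
  congr 2
  ext z
  simp [Prod.ext_iff]

theorem integral_eq_sum_of_law {X ι : Type*} [MeasurableSpace X]
    [Fintype ι] [MeasurableSpace ι] [MeasurableSingletonClass ι]
    (μ : Measure X) [IsFiniteMeasure μ] {s : X → ι} (hs : Measurable s) (g : ι → ℝ) :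
    ∫ x, g (s x) ∂μ = ∑ i, g i * μ.real (s ⁻¹' {i}) := by
  rw [← integral_map (μ := μ) hs.aemeasurable (f := g)
    (measurable_of_finite _).aestronglyMeasurable, integral_fintype .of_finite]
  refine Finset.sum_congr rfl fun i _ => ?_
  rw [map_measureReal_apply hs (measurableSet_singleton _), smul_eq_mul, mul_comm]

theorem sum_measureReal_fiber {X ι : Type*} [MeasurableSpace X]
    [Fintype ι] [MeasurableSpace ι] [MeasurableSingletonClass ι]
    (μ : Measure X) [IsProbabilityMeasure μ] {s : X → ι} (hs : Measurable s) :
    ∑ i, μ.real (s ⁻¹' {i}) = 1 := by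
  simpa using (integral_eq_sum_of_law μ hs fun _ => 1).symm

/-! ### The truncated metric and its convex functions -/

section Cost

variable {X : Type*} [MetricSpace X] {lam : ℝ}

theorem truncCost_nonneg (hlam : 0 < lam) (x y : X) : 0 ≤ truncCost lam x y :=
  le_min dist_nonneg (by linarith)

theorem truncCost_le (x y : X) : truncCost lam x y ≤ 2 * lam := min_le_right _ _

theorem truncCost_le_dist (x y : X) : truncCost lam x y ≤ dist x y := min_le_left _ _

theorem truncCost_self (hlam : 0 < lam) (x : X) : truncCost lam x x = 0 := by
  simp [truncCost, hlam.le]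

theorem truncCost_comm (x y : X) : truncCost lam x y = truncCost lam y x := by
  simp [truncCost, dist_comm]

theorem truncCost_triangle (hlam : 0 < lam) (x y z : X) :
    truncCost lam x z ≤ truncCost lam x y + truncCost lam y z := by
  have h1 := truncCost_nonneg hlam x y
  have h2 := truncCost_nonneg hlam y z
  unfold truncCost at *
  have := dist_triangle x y z
  rcases min_cases (dist x y) (2 * lam) with h | h <;>
  rcases min_cases (dist y z) (2 * lam) with h' | h' <;>
  rcases min_cases (dist x z) (2 * lam) with h'' | h'' <;> linarith

theorem continuous_truncCost : Continuous fun p : X × X => truncCost lam p.1 p.2 :=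
  continuous_dist.min continuous_const

theorem robustFeasible_iff {ψ : X →ᵇ ℝ} :
    RobustFeasible lam ψ ↔ ∀ x y, ψ x - ψ y ≤ truncCost lam x y := by
  refine ⟨fun h x y => le_min ((le_abs_self _).trans (h.1 x y)) (h.2 x y), fun h => ⟨?_, ?_⟩⟩
  · intro x y
    refine abs_sub_le_iff.2 ⟨(h x y).trans (truncCost_le_dist x y), ?_⟩
    rw [dist_comm]
    exact (h y x).trans (truncCost_le_dist y x)
  · exact fun x y => (h x y).trans (truncCost_le x y)

/-- A function that is `1`-Lipschitz for the truncated cost is bounded and continuous. -/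
theorem exists_robustFeasible_eq (f : X → ℝ)
    (hf : ∀ x y, f x - f y ≤ truncCost lam x y) :
    ∃ ψ : X →ᵇ ℝ, RobustFeasible lam ψ ∧ ⇑ψ = f := by
  have hlip : LipschitzWith 1 f := LipschitzWith.of_le_add fun x y => by
    linarith [(hf x y).trans (truncCost_le_dist x y)]
  refine ⟨BoundedContinuousFunction.mkOfBound ⟨f, hlip.continuous⟩ (2 * lam) fun x y => ?_, ?_, rfl⟩
  · rw [Real.dist_eq]
    exact abs_sub_le_iff.2 ⟨(hf x y).trans (truncCost_le x y), (hf y x).trans (truncCost_le y x)⟩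
  · exact robustFeasible_iff.2 hf

/-- Inf-convolution of dual variables with the truncated cost. -/
theorem exists_robustFeasible_between (hlam : 0 < lam) {κ : Type*} [Finite κ] [Nonempty κ]
    (g : κ → X) (w : κ → ℝ) :
    ∃ ψ : X →ᵇ ℝ, RobustFeasible lam ψ ∧ (∀ j, ψ (g j) ≤ w j) ∧
      ∀ x r, (∀ j, r - w j ≤ truncCost lam x (g j)) → r ≤ ψ x := by
  have hbdd : ∀ x, BddBelow (Set.range fun j => w j + truncCost lam x (g j)) :=
    fun x => (Set.finite_range _).bddBelow
  -- An infimum of functions that are 1-Lipschitz for `c_λ` is again 1-Lipschitz.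
  obtain ⟨ψ, hψ, hψe⟩ := exists_robustFeasible_eq
    (fun x => ⨅ j, (w j + truncCost lam x (g j))) fun x y => by
      rw [sub_le_iff_le_add, ← sub_le_iff_le_add']
      refine le_ciInf fun j => ?_
      have := ciInf_le (hbdd x) j
      have h2 := truncCost_triangle hlam x y (g j)
      linarith
  refine ⟨ψ, hψ, fun j => ?_, fun x r h => ?_⟩
  · rw [hψe]
    refine (ciInf_le (hbdd (g j)) j).trans ?_
    rw [truncCost_self hlam, add_zero]
  · rw [hψe]
    exact le_ciInf fun j => by linarith [h j]

/-- Each function `ζ z - c_λ(·, z)` is 1-Lipschitz by the triangle inequality, hence so is the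
supremum; finiteness at one point then spreads everywhere. -/
theorem IsCConvex.exists_real (hlam : 0 < lam) {ψ : X → EReal}
    (h : IsCConvex (truncCost (X := X) lam) ψ) :
    ∃ f : X → ℝ, (∀ x, ψ x = f x) ∧ ∀ x y, f x - f y ≤ truncCost lam x y := by
  obtain ⟨hbot, ⟨x₀, hx₀⟩, ζ, hζ⟩ := h
  have hle : ∀ x y, ψ x ≤ ψ y + (truncCost lam x y : ℝ) := by
    intro x y
    conv_lhs => rw [hζ x]
    refine iSup_le fun z => ?_
    have h1 : ζ z - ((truncCost lam y z : ℝ) : EReal) ≤ ψ y := by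
      rw [hζ y]
      exact le_iSup (fun z => ζ z - ((truncCost lam y z : ℝ) : EReal)) z
    have h3 : truncCost lam y z - truncCost lam x y ≤ truncCost lam x z := by
      have := truncCost_triangle hlam y x z
      rw [truncCost_comm y x] at this
      linarith
    rw [EReal.sub_le_iff_le_add (Or.inl (EReal.coe_ne_bot _)) (Or.inl (EReal.coe_ne_top _))] at h1 ⊢
    refine h1.trans ?_
    rw [add_assoc]
    refine add_le_add le_rfl ?_
    exact_mod_cast by linarith
  have htop : ∀ x, ψ x ≠ ⊤ := by
    intro x hx
    have := hle x x₀
    rw [hx, top_le_iff] at this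
    exact EReal.add_ne_top hx₀ (EReal.coe_ne_top _) this
  refine ⟨fun x => (ψ x).toReal, fun x => (EReal.coe_toReal (htop x) (hbot x)).symm, fun x y => ?_⟩
  have := hle x y
  rw [← EReal.coe_toReal (htop x) (hbot x), ← EReal.coe_toReal (htop y) (hbot y)] at this
  have h' : (ψ x).toReal ≤ (ψ y).toReal + truncCost lam x y := by exact_mod_cast this
  linarith

/-- The choice `x = y` gives one bound, the Lipschitz condition the other. -/
theorem cTransform_coe_eq_self (hlam : 0 < lam) {f : X → ℝ}
    (hf : ∀ x y, f x - f y ≤ truncCost lam x y) (y : X) :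
    cTransform (truncCost (X := X) lam) (fun x => (f x : EReal)) y = f y := by
  refine le_antisymm ?_ (le_iInf fun x => ?_)
  · refine (iInf_le (fun x => (f x : EReal) + ((truncCost lam x y : ℝ) : EReal)) y).trans ?_
    simp [truncCost_self hlam]
  · have := hf y x
    rw [truncCost_comm] at this
    rw [← EReal.coe_add, EReal.coe_le_coe_iff]
    linarith

/-- Here `ζ = f` works, with the supremum attained at `y = x`. -/
theorem isCConvex_coe (hlam : 0 < lam) [Nonempty X] {f : X → ℝ}
    (hf : ∀ x y, f x - f y ≤ truncCost lam x y) :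
    IsCConvex (truncCost (X := X) lam) (fun x => (f x : EReal)) := by
  refine ⟨fun x => EReal.coe_ne_bot _, ⟨Classical.arbitrary X, EReal.coe_ne_top _⟩,
    fun y => (f y : EReal), fun x => le_antisymm ?_ (iSup_le fun y => ?_)⟩
  · refine le_trans ?_ (le_iSup (fun y => (f y : EReal) - ((truncCost lam x y : ℝ) : EReal)) x)
    simp [truncCost_self hlam]
  · have := hf y x
    rw [truncCost_comm] at this
    rw [← EReal.coe_sub, EReal.coe_le_coe_iff]
    linarith

end Cost

/-! ### Couplings, weak duality and discretization -/

section Measure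

variable {X : Type*} [MetricSpace X] [MeasurableSpace X] [BorelSpace X]
  [SecondCountableTopology X] {lam : ℝ}

theorem robustValue_le {X : Type*} [MetricSpace X] [MeasurableSpace X] {lam : ℝ}
    (hlam : 0 < lam) {μ ν : Measure X} {π : Measure (X × X)} (hπ : π ∈ couplings μ ν) :
    robustValue lam μ ν ≤ ∫ p, truncCost lam p.1 p.2 ∂π := by
  refine csInf_le ⟨0, ?_⟩ ⟨π, hπ, rfl⟩
  rintro _ ⟨π, -, rfl⟩
  exact integral_nonneg fun p => truncCost_nonneg hlam _ _

theorem integrable_truncCost (hlam : 0 < lam) {Ω : Type*} [MeasurableSpace Ω] (π : Measure Ω)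
    [IsFiniteMeasure π] {u v : Ω → X} (hu : Measurable u) (hv : Measurable v) :
    Integrable (fun ω => truncCost lam (u ω) (v ω)) π := by
  refine Integrable.of_bound (C := 2 * lam)
    (continuous_truncCost.measurable.comp (hu.prodMk hv)).aestronglyMeasurable
    (Filter.Eventually.of_forall fun ω => ?_)
  rw [Real.norm_of_nonneg (truncCost_nonneg hlam _ _)]
  exact truncCost_le _ _

theorem isProbabilityMeasure_of_mem_couplings {X Y : Type*} [MeasurableSpace X]
    [MeasurableSpace Y] {μ : Measure X} {ν : Measure Y} [IsProbabilityMeasure μ]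
    {π : Measure (X × Y)} (hπ : π ∈ couplings μ ν) : IsProbabilityMeasure π := by
  constructor
  rw [← Set.preimage_univ (f := Prod.fst), ← Measure.map_apply measurable_fst .univ, hπ.1,
    measure_univ]

theorem integral_fst_of_mem_couplings {X Y : Type*} [MeasurableSpace X]
    [MeasurableSpace Y] {μ : Measure X} {ν : Measure Y} {π : Measure (X × Y)}
    (hπ : π ∈ couplings μ ν) {f : X → ℝ} (hf : AEStronglyMeasurable f μ) :
    ∫ z, f z.1 ∂π = ∫ x, f x ∂μ := by
  have h := hπ.1
  subst h
  exact (integral_map measurable_fst.aemeasurable hf).symm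

theorem integral_snd_of_mem_couplings {X Y : Type*} [MeasurableSpace X]
    [MeasurableSpace Y] {μ : Measure X} {ν : Measure Y} {π : Measure (X × Y)}
    (hπ : π ∈ couplings μ ν) {f : Y → ℝ} (hf : AEStronglyMeasurable f ν) :
    ∫ z, f z.2 ∂π = ∫ y, f y ∂ν := by
  have h := hπ.2
  subst h
  exact (integral_map measurable_snd.aemeasurable hf).symm

variable (μ ν : Measure X) [IsProbabilityMeasure μ] [IsProbabilityMeasure ν]

/-- Weak duality. -/
theorem dual_le_robustValue (hlam : 0 < lam) (φ ψ : X →ᵇ ℝ)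
    (h : ∀ x y, φ y - ψ x ≤ truncCost lam x y) :
    ∫ x, φ x ∂μ - ∫ x, ψ x ∂ν ≤ robustValue lam μ ν := by
  refine le_csInf ⟨_, μ.prod ν, ⟨by simp, by simp⟩, rfl⟩ ?_
  rintro _ ⟨π, hπ, rfl⟩
  have := isProbabilityMeasure_of_mem_couplings hπ
  have hφ := φ.continuous.measurable.aestronglyMeasurable (μ := μ)
  have hψ := ψ.continuous.measurable.aestronglyMeasurable (μ := ν)
  have hiφ : Integrable (fun z : X × X => φ z.1) π :=
    (φ.compContinuous ⟨Prod.fst, continuous_fst⟩).integrable π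
  have hiψ : Integrable (fun z : X × X => ψ z.2) π :=
    (ψ.compContinuous ⟨Prod.snd, continuous_snd⟩).integrable π
  rw [← integral_fst_of_mem_couplings hπ hφ, ← integral_snd_of_mem_couplings hπ hψ,
    ← integral_sub hiφ hiψ]
  refine integral_mono (hiφ.sub hiψ) (integrable_truncCost hlam π measurable_fst measurable_snd)
    fun z => ?_
  rw [truncCost_comm]
  exact h z.2 z.1

open Filter Topology in
-- Nearest points among the first terms of a dense sequence converge to `x`; the bound `2λ` allows
-- dominated convergence, and one index serves both measures.
theorem exists_simpleFunc_approx (hlam : 0 < lam) {ε : ℝ} (hε : 0 < ε) :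
    ∃ s : SimpleFunc X X, ∫ x, truncCost lam x (s x) ∂μ < ε ∧
      ∫ x, truncCost lam x (s x) ∂ν < ε := by
  have : Nonempty X := μ.nonempty_of_neZero
  have key : ∀ (m : Measure X) [IsProbabilityMeasure m], Tendsto
      (fun N => ∫ x, truncCost lam x
        (SimpleFunc.nearestPt (TopologicalSpace.denseSeq X) N x) ∂m) atTop (𝓝 0) := by
    intro m _
    have h0 : ∫ x : X, truncCost lam x x ∂m = 0 := by simp [truncCost_self hlam]
    rw [← h0]
    refine tendsto_integral_of_dominated_convergence (fun _ => 2 * lam) (fun N => ?_)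
      (integrable_const _) (fun N => Eventually.of_forall fun x => ?_)
      (Eventually.of_forall fun x => ?_)
    · exact (integrable_truncCost hlam m measurable_id (SimpleFunc.measurable _)).1
    · rw [Real.norm_of_nonneg (truncCost_nonneg hlam _ _)]
      exact truncCost_le _ _
    · have hx : x ∈ closure (Set.range (TopologicalSpace.denseSeq X)) :=
        TopologicalSpace.denseRange_denseSeq X x
      exact (continuous_truncCost.tendsto (x, x)).comp
        (tendsto_const_nhds.prodMk_nhds (SimpleFunc.tendsto_nearestPt hx))
  obtain ⟨N, h1, h2⟩ := (((key μ).eventually_lt_const hε).and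
    ((key ν).eventually_lt_const hε)).exists
  exact ⟨_, h1, h2⟩

end Measure

/-! ### Strong duality and attainment -/

section Duality

variable {X : Type*} [MetricSpace X] [MeasurableSpace X] [BorelSpace X]
  [SecondCountableTopology X] {lam : ℝ}
  (μ ν : Measure X) [IsProbabilityMeasure μ] [IsProbabilityMeasure ν]

/-- Replacing `x` by `s x` costs less than `ε / 4` per measure, once in the primal and once in the
dual: less than `ε` in all. -/
theorem exists_robustFeasible_gt (hlam : 0 < lam) {ε : ℝ} (hε : 0 < ε) :
    ∃ ψ : X →ᵇ ℝ, RobustFeasible lam ψ ∧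
      robustValue lam μ ν - ε < ∫ x, ψ x ∂μ - ∫ x, ψ x ∂ν := by
  obtain ⟨s, hsμ, hsν⟩ := exists_simpleFunc_approx μ ν hlam (show 0 < ε / 4 by linarith)
  let t : X → s.range := fun x => ⟨s x, s.mem_range_self x⟩
  have ht : Measurable t := s.measurable.subtype_mk
  have : Nonempty X := μ.nonempty_of_neZero
  have : Nonempty s.range := ⟨t (Classical.arbitrary X)⟩
  have hlow : ∀ p : s.range → s.range → ℝ, (∀ i j, 0 ≤ p i j) →
      (∀ i, ∑ j, p i j = μ.real (t ⁻¹' {i})) → (∀ j, ∑ i, p i j = ν.real (t ⁻¹' {j})) →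
      robustValue lam μ ν - ε / 2 < ∑ i, ∑ j, p i j * truncCost lam (i : X) (j : X) := by
    intro p hp hrow hcol
    obtain ⟨π, hπ, hπp⟩ := exists_coupling_of_matrix μ ν ht ht p hp hrow hcol
    have := isProbabilityMeasure_of_mem_couplings hπ
    have hsum := integral_eq_sum_of_joint_law π ht ht fun i j => truncCost lam (i : X) (j : X)
    simp only [hπp] at hsum
    have hm1 : Measurable fun z : X × X => s z.1 := s.measurable.comp measurable_fst
    have hm2 : Measurable fun z : X × X => s z.2 := s.measurable.comp measurable_snd
    have i1 := integrable_truncCost hlam π measurable_fst hm1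
    have i2 := integrable_truncCost hlam π measurable_snd hm2
    have i3 := integrable_truncCost hlam π hm1 hm2
    have e1 := integral_fst_of_mem_couplings hπ
      (integrable_truncCost hlam μ measurable_id s.measurable).1
    have e2 := integral_snd_of_mem_couplings hπ
      (integrable_truncCost hlam ν measurable_id s.measurable).1
    simp only [id] at e1 e2
    -- Triangle inequality along `z.1`, `s z.1`, `s z.2`, `z.2`.
    have hle : ∫ z, truncCost lam z.1 z.2 ∂π ≤ ∫ z, (truncCost lam z.1 (s z.1)
        + truncCost lam z.2 (s z.2) + truncCost lam (s z.1) (s z.2)) ∂π := by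
      refine integral_mono (integrable_truncCost hlam π measurable_fst measurable_snd)
        ((i1.add i2).add i3) fun z => ?_
      have h1 := truncCost_triangle hlam z.1 (s z.1) z.2
      have h2 := truncCost_triangle hlam (s z.1) (s z.2) z.2
      rw [truncCost_comm (s z.2)] at h2
      simp only
      linarith
    rw [integral_add (by exact i1.add i2) i3, integral_add i1 i2, e1, e2] at hle
    have := robustValue_le hlam hπ
    simp only [t] at hsum
    linarith
  obtain ⟨φ, w, hφw, hval⟩ := exists_dual_of_lt_cost
    (fun i j : s.range => truncCost lam (i : X) (j : X))
    (fun i => μ.real (t ⁻¹' {i})) (fun j => ν.real (t ⁻¹' {j}))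
    (fun _ => measureReal_nonneg) (fun _ => measureReal_nonneg)
    (sum_measureReal_fiber μ ht) (sum_measureReal_fiber ν ht) _ hlow
  obtain ⟨ψ, hψ, hψw, hψφ⟩ := exists_robustFeasible_between hlam
    (Subtype.val : s.range → X) w
  refine ⟨ψ, hψ, ?_⟩
  have hψc := robustFeasible_iff.1 hψ
  rw [← integral_eq_sum_of_law μ ht φ, ← integral_eq_sum_of_law ν ht w] at hval
  have hfin : ∀ (m : Measure X) [IsProbabilityMeasure m] (g : s.range → ℝ),
      Integrable (fun x => g (t x)) m := by
    intro m _ g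
    obtain ⟨C, hC⟩ := (Set.finite_range fun i => ‖g i‖).bddAbove
    exact Integrable.of_bound ((measurable_of_finite g).comp ht).aestronglyMeasurable C
      (Filter.Eventually.of_forall fun x => hC ⟨t x, rfl⟩)
  have cμ : Integrable (fun x => truncCost lam x (s x)) μ :=
    integrable_truncCost hlam μ measurable_id s.measurable
  have cν : Integrable (fun x => truncCost lam x (s x)) ν :=
    integrable_truncCost hlam ν measurable_id s.measurable
  have h1 : ∫ x, φ (t x) ∂μ ≤ ∫ x, (ψ x + truncCost lam x (s x)) ∂μ := by
    refine integral_mono (hfin μ φ) ((ψ.integrable μ).add cμ) fun x => ?_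
    have h1 : φ (t x) ≤ ψ (s x) := hψφ (s x) _ fun j => hφw (t x) j
    have h2 := hψc (s x) x
    rw [truncCost_comm] at h2
    simp only
    linarith
  have h2 : ∫ x, ψ x ∂ν ≤ ∫ x, (w (t x) + truncCost lam x (s x)) ∂ν := by
    refine integral_mono (ψ.integrable ν) ((hfin ν w).add cν) fun x => ?_
    have h1 : ψ (s x) ≤ w (t x) := hψw (t x)
    have h2 := hψc x (s x)
    simp only
    linarith
  rw [integral_add (ψ.integrable μ) cμ] at h1
  rw [integral_add (hfin ν w) cν] at h2
  linarith

open Filter Topology in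
/-- Arzelà–Ascoli for normalized feasible functions: a subsequence converges pointwise. -/
theorem exists_subseq_tendsto_of_truncCost {X : Type*} [MetricSpace X]
    [TopologicalSpace.SeparableSpace X] [Nonempty X] {lam : ℝ} (f : ℕ → X → ℝ)
    (hf : ∀ n x y, f n x - f n y ≤ truncCost lam x y)
    (hb : ∀ n x, f n x ∈ Set.Icc (-(2 * lam)) (2 * lam)) :
    ∃ g : X → ℝ, ∃ k : ℕ → ℕ, StrictMono k ∧
      ∀ x, Tendsto (fun n => f (k n) x) atTop (𝓝 (g x)) := by
  let D := TopologicalSpace.denseSeq X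
  -- Compactness of a product of intervals gives convergence on a dense sequence; the common
  -- Lipschitz bound carries it to every point.
  obtain ⟨a, -, k, hk, ha⟩ := (isCompact_univ_pi fun _ : ℕ =>
    isCompact_Icc (a := -(2 * lam)) (b := 2 * lam)).tendsto_subseq
    (x := fun n i => f n (D i)) fun n i _ => hb n (D i)
  rw [tendsto_pi_nhds] at ha
  have hc : ∀ x, CauchySeq fun n => f (k n) x := by
    intro x
    refine Metric.cauchySeq_iff.2 fun ε hε => ?_
    obtain ⟨i, hi⟩ := (TopologicalSpace.denseRange_denseSeq X).exists_dist_lt x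
      (show 0 < ε / 3 by linarith)
    obtain ⟨N, hN⟩ := Metric.cauchySeq_iff.1 (ha i).cauchySeq (ε / 3) (by linarith)
    have hlip : ∀ n, |f n x - f n (D i)| < ε / 3 := fun n => by
      refine lt_of_le_of_lt (abs_sub_le_iff.2 ⟨(hf n _ _).trans (truncCost_le_dist _ _), ?_⟩) hi
      rw [dist_comm]
      exact (hf n _ _).trans (truncCost_le_dist _ _)
    refine ⟨N, fun m hm n hn => ?_⟩
    have h := hN m hm n hn
    simp only [Function.comp_apply, Real.dist_eq] at h ⊢
    have h1 := abs_lt.1 (hlip (k m))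
    have h2 := abs_lt.1 (hlip (k n))
    have h3 := abs_lt.1 h
    exact abs_lt.2 ⟨by linarith [h1.1, h2.2, h3.1], by linarith [h1.2, h2.1, h3.2]⟩
  choose g hg using fun x => cauchySeq_tendsto_of_complete (hc x)
  exact ⟨g, k, hk, hg⟩

open Filter Topology in
-- Subtracting `ψ n x₀` leaves the dual value unchanged, since both measures have mass 1, and makes
-- a maximizing sequence uniformly bounded.
theorem exists_robustFeasible_eq_robustValue (hlam : 0 < lam) :
    ∃ ψ : X →ᵇ ℝ, RobustFeasible lam ψ ∧
      robustValue lam μ ν = ∫ x, ψ x ∂μ - ∫ x, ψ x ∂ν := by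
  have : Nonempty X := μ.nonempty_of_neZero
  let x₀ : X := Classical.arbitrary X
  choose ψ hψ hval using fun n : ℕ =>
    exists_robustFeasible_gt μ ν hlam (ε := 1 / ((n : ℝ) + 1)) (by positivity)
  have hψc := fun n => robustFeasible_iff.1 (hψ n)
  have hb : ∀ n x, ψ n x - ψ n x₀ ∈ Set.Icc (-(2 * lam)) (2 * lam) := fun n x =>
    ⟨by linarith [(hψ n).2 x₀ x], (hψ n).2 x x₀⟩
  obtain ⟨g, k, hk, hg⟩ := exists_subseq_tendsto_of_truncCost
    (fun n x => ψ n x - ψ n x₀) (fun n x y => by linarith [hψc n x y]) hb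
  obtain ⟨χ, hχ, hχg⟩ := exists_robustFeasible_eq (lam := lam) g fun x y =>
    le_of_tendsto ((hg x).sub (hg y))
      (Eventually.of_forall fun n => by linarith [hψc (k n) x y])
  have hlim : ∀ (m : Measure X) [IsProbabilityMeasure m],
      Tendsto (fun n => ∫ x, (ψ (k n) x - ψ (k n) x₀) ∂m) atTop (𝓝 (∫ x, χ x ∂m)) := by
    intro m _
    rw [hχg]
    refine tendsto_integral_of_dominated_convergence (fun _ => 2 * lam) (fun n => ?_)
      (integrable_const _) (fun n => Eventually.of_forall fun x => ?_)
      (Eventually.of_forall hg)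
    · exact (((ψ (k n)).integrable m).sub (integrable_const _)).1
    · exact abs_le.2 (hb (k n) x)
  refine ⟨χ, hχ, le_antisymm ?_ ?_⟩
  · have h1 : Tendsto (fun n => robustValue lam μ ν - 1 / ((k n : ℝ) + 1)) atTop
        (𝓝 (robustValue lam μ ν - 0)) :=
      tendsto_const_nhds.sub
        ((tendsto_one_div_add_atTop_nhds_zero_nat (𝕜 := ℝ)).comp hk.tendsto_atTop)
    rw [sub_zero] at h1
    refine le_of_tendsto_of_tendsto' h1 ((hlim μ).sub (hlim ν)) fun n => ?_
    rw [integral_sub ((ψ (k n)).integrable μ) (integrable_const _),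
      integral_sub ((ψ (k n)).integrable ν) (integrable_const _)]
    simp only [integral_const, probReal_univ, one_smul]
    linarith [hval (k n)]
  · exact dual_le_robustValue μ ν hlam χ χ fun x y => by
      rw [truncCost_comm]
      exact robustFeasible_iff.1 hχ y x

theorem isGreatest_robustDualValues (hlam : 0 < lam) :
    IsGreatest (robustDualValues lam μ ν) (robustValue lam μ ν) := by
  refine ⟨exists_robustFeasible_eq_robustValue μ ν hlam, ?_⟩
  rintro _ ⟨ψ, hψ, rfl⟩
  exact dual_le_robustValue μ ν hlam ψ ψ fun x y => by
    rw [truncCost_comm]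
    exact robustFeasible_iff.1 hψ y x

end Duality

end RobustOT

/-! ### The main theorem -/

theorem theorem3 {X : Type*} [MetricSpace X] [CompleteSpace X]
    [TopologicalSpace.SeparableSpace X] [MeasurableSpace X] [BorelSpace X]
    (lam : ℝ) (hlam : 0 < lam)
    (μ ν : Measure X) [IsProbabilityMeasure μ] [IsProbabilityMeasure ν] :
    -- every `c_λ`-convex function is its own `c_λ`-transform
    (∀ ψ : X → EReal, RobustOT.IsCConvex (RobustOT.truncCost (X := X) lam) ψ →
      RobustOT.cTransform (RobustOT.truncCost (X := X) lam) ψ = ψ) ∧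
    -- the primal value is the supremum of the robust dual problem, and the supremum is attained
    IsGreatest (RobustOT.robustDualValues lam μ ν) (RobustOT.robustValue lam μ ν) ∧
    -- a Kantorovich potential exists, and each one solves the robust dual problem
    (∃ ψ : BoundedContinuousFunction X ℝ,
      RobustOT.IsKantorovichPotential (RobustOT.truncCost (X := X) lam) ν μ ψ) ∧
    (∀ ψ : BoundedContinuousFunction X ℝ,
      RobustOT.IsKantorovichPotential (RobustOT.truncCost (X := X) lam) ν μ ψ →
        RobustOT.RobustFeasible lam ψ ∧
        IsGreatest (RobustOT.robustDualValues lam μ ν) (∫ x, ψ x ∂μ - ∫ x, ψ x ∂ν)) := by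
  have : SecondCountableTopology X := UniformSpace.secondCountable_of_separable X
  have : Nonempty X := μ.nonempty_of_neZero
  refine ⟨fun ψ hψ => ?_, RobustOT.isGreatest_robustDualValues μ ν hlam, ?_, fun ψ hψ => ?_⟩
  · obtain ⟨f, hψf, hf⟩ := hψ.exists_real hlam
    obtain rfl : ψ = fun x => (f x : EReal) := funext hψf
    exact funext (RobustOT.cTransform_coe_eq_self hlam hf)
  · obtain ⟨ψ, hψ, hval⟩ := RobustOT.exists_robustFeasible_eq_robustValue μ ν hlam
    have hψc := RobustOT.robustFeasible_iff.1 hψ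
    refine ⟨ψ, RobustOT.isCConvex_coe hlam hψc, ψ,
      fun y => (RobustOT.cTransform_coe_eq_self hlam hψc y).symm, ?_, ?_⟩
    · exact ⟨ψ, ψ, fun x y => by
        rw [RobustOT.truncCost_comm]
        exact hψc y x, rfl⟩
    · rintro _ ⟨φ, χ, h, rfl⟩
      rw [← hval]
      exact RobustOT.dual_le_robustValue μ ν hlam φ χ h
  · obtain ⟨hconv, φ, hφ, hmax⟩ := hψ
    obtain ⟨f, hψf, hf⟩ := hconv.exists_real hlam
    obtain rfl : ⇑ψ = f := funext fun x => EReal.coe_eq_coe_iff.1 (hψf x)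
    -- Self-transformation identifies the two members of the pair; optimality is then tested only
    -- against pairs `(χ, χ)`.
    obtain rfl : φ = ψ := BoundedContinuousFunction.ext fun y => EReal.coe_eq_coe_iff.1
      ((hφ y).trans (RobustOT.cTransform_coe_eq_self hlam hf y))
    refine ⟨RobustOT.robustFeasible_iff.2 hf, ⟨φ, RobustOT.robustFeasible_iff.2 hf, rfl⟩, ?_⟩
    rintro _ ⟨χ, hχ, rfl⟩
    exact hmax.2 ⟨χ, χ, fun x y => by
      rw [RobustOT.truncCost_comm]
      exact RobustOT.robustFeasible_iff.1 hχ y x, rfl⟩
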